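/- Let $K$ be a field. For a coalgebra $C$ over $K$, let $C^*=\mathrm{Hom}_K(C,K)$ be the dual algebra, with the convolution product $(fg)(c)=\sum f(c_1)g(c_2)$ and unit $\epsilon$. Then $C$ is a left $C^*$-module via $f\cdot c=\sum f(c_2)c_1$ and a right $C^*$-module via $c\cdot f=\sum f(c_1)c_2$. The coalgebra $C$ is called left (right) co-Frobenius if it embeds in $C^*$ as a left (right) $C^*$-module, and left (right) quasi-co-Frobenius (QcF) if it embeds in a free left (right) $C^*$-module. It is called cosemisimple if it is the sum of its simple subcoalgebras. For a quiver $\Gamma$, the path coalgebra $K\Gamma$ is the $K$-vector space with basis all the paths of $\Gamma$ (of length $\ge 0$, the vertices being the paths of length $0$), with $\Delta(p)=\sum_{qr=p}q\otimes r$ for every path $p$, $\epsilon(v)=1$ for every vertex $v$, and $\epsilon(p)=0$ for every path $p$ of positive length. For a locally finite partially ordered set $X$, the incidence coalgebra $KX$ is the $K$-vector space with basis $\{e_{x,y}\mid x,y\in X,\ x\le y\}$, with $\Delta(e_{x,y})=\sum_{x\le z\le y}e_{x,z}\otimes e_{z,y}$ and $\epsilon(e_{x,y})=\delta_{x,y}$.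 **Theorem.** (1) Let $\Gamma$ be a quiver and $C=K\Gamma$. The following are equivalent: (i) $C$ is cosemisimple; (i') $\Gamma$ has no arrows; (ii) $C$ is left QcF; (iii) $C$ is left co-Frobenius; (iv) $C$ is right QcF; (v) $C$ is right co-Frobenius. (2) Let $X$ be a locally finite partially ordered set and $C=KX$. The following are equivalent: (i) $C$ is cosemisimple; (i') the order relation on $X$ is the equality; (ii) $C$ is left QcF; (iii) $C$ is left co-Frobenius; (iv) $C$ is right QcF; (v) $C$ is right co-Frobenius. -/

import Mathlib

open scoped TensorProduct

universe u v w

/-! ## Coalgebras: dual algebra, its actions on `C`, and Frobenius type properties -/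

section Coalg

variable (K : Type u) (C : Type v) [Field K] [AddCommGroup C] [Module K C] [Coalgebra K C]

/-- The dual algebra `C^*` of a coalgebra, with the convolution product
`(f * g)(c) = ∑ f(c₁) g(c₂)` and unit the counit of `C`. -/
abbrev DualAlg : Type (max u v) := WithConv (C →ₗ[K] K)

variable {K C}

/-- The linear map `c ↦ ∑ f(c₂) c₁`. -/
noncomputable def leftHit (f : DualAlg K C) : C →ₗ[K] C :=
  (TensorProduct.rid K C).toLinearMap ∘ₗ f.ofConv.lTensor C ∘ₗ Coalgebra.comul

/-- The linear map `c ↦ ∑ f(c₁) c₂`. -/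
noncomputable def rightHit (f : DualAlg K C) : C →ₗ[K] C :=
  (TensorProduct.lid K C).toLinearMap ∘ₗ f.ofConv.rTensor C ∘ₗ Coalgebra.comul

theorem leftHit_repr {ι : Type*} (f : DualAlg K C) {c : C} (r : Coalgebra.Repr K c ι) :
    leftHit f c = ∑ i ∈ r.index, f.ofConv (r.right i) • r.left i := by
  simp [leftHit, ← r.eq]

theorem rightHit_repr {ι : Type*} (f : DualAlg K C) {c : C} (r : Coalgebra.Repr K c ι) :
    rightHit f c = ∑ i ∈ r.index, f.ofConv (r.left i) • r.right i := by
  simp [rightHit, ← r.eq]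

theorem leftHit_one (c : C) : leftHit (1 : DualAlg K C) c = c := by
  have h : (1 : DualAlg K C).ofConv = Coalgebra.counit := by ext; rfl
  simp [leftHit, h]

theorem rightHit_one (c : C) : rightHit (1 : DualAlg K C) c = c := by
  have h : (1 : DualAlg K C).ofConv = Coalgebra.counit := by ext; rfl
  simp [rightHit, h]

theorem leftHit_mul (f g : DualAlg K C) (c : C) :
    leftHit (f * g) c = leftHit f (leftHit g c) := by
  have key : ∀ t : C ⊗[K] (C ⊗[K] C),
      TensorProduct.rid K C ((LinearMap.lTensor C
        (LinearMap.mul' K K ∘ₗ TensorProduct.map f.ofConv g.ofConv)) t) =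
      TensorProduct.rid K C (f.ofConv.lTensor C (TensorProduct.rid K (C ⊗[K] C)
        (g.ofConv.lTensor (C ⊗[K] C) ((TensorProduct.assoc K C C C).symm t)))) := by
    intro t
    induction t using TensorProduct.induction_on with
    | zero => simp
    | add x y hx hy => simp only [map_add, hx, hy]
    | tmul x y =>
      induction y using TensorProduct.induction_on with
      | zero => simp
      | add y z hy hz => simp only [TensorProduct.tmul_add, map_add, hy, hz]
      | tmul y z =>
        simp only [LinearMap.lTensor_tmul, LinearMap.comp_apply, TensorProduct.map_tmul,
          LinearMap.mul'_apply, TensorProduct.rid_tmul, TensorProduct.assoc_symm_tmul, map_smul]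
        rw [smul_smul, mul_comm]
  have comm : ∀ s : C ⊗[K] C, Coalgebra.comul (TensorProduct.rid K C (g.ofConv.lTensor C s)) =
      TensorProduct.rid K (C ⊗[K] C)
        (g.ofConv.lTensor (C ⊗[K] C) (Coalgebra.comul.rTensor C s)) := by
    intro s
    induction s using TensorProduct.induction_on with
    | zero => simp
    | add x y hx hy => simp only [map_add, hx, hy]
    | tmul x y => simp
  have e : (f * g).ofConv =
      (LinearMap.mul' K K ∘ₗ TensorProduct.map f.ofConv g.ofConv) ∘ₗ Coalgebra.comul := rfl
  have k := key (Coalgebra.comul.lTensor C (Coalgebra.comul c))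
  rw [Coalgebra.coassoc_symm_apply, ← comm] at k
  simp only [leftHit, e, LinearMap.lTensor_comp, LinearMap.comp_apply, LinearEquiv.coe_coe]
    at k ⊢
  exact k

theorem rightHit_mul (f g : DualAlg K C) (c : C) :
    rightHit (f * g) c = rightHit g (rightHit f c) := by
  have key : ∀ t : (C ⊗[K] C) ⊗[K] C,
      TensorProduct.lid K C ((LinearMap.rTensor C
        (LinearMap.mul' K K ∘ₗ TensorProduct.map f.ofConv g.ofConv)) t) =
      TensorProduct.lid K C (g.ofConv.rTensor C (TensorProduct.lid K (C ⊗[K] C)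
        (f.ofConv.rTensor (C ⊗[K] C) (TensorProduct.assoc K C C C t)))) := by
    intro t
    induction t using TensorProduct.induction_on with
    | zero => simp
    | add x y hx hy => simp only [map_add, hx, hy]
    | tmul x z =>
      induction x using TensorProduct.induction_on with
      | zero => simp
      | add y z hy hz => simp only [TensorProduct.add_tmul, map_add, hy, hz]
      | tmul x y => simp [mul_smul]
  have comm : ∀ s : C ⊗[K] C, Coalgebra.comul (TensorProduct.lid K C (f.ofConv.rTensor C s)) =
      TensorProduct.lid K (C ⊗[K] C)
        (f.ofConv.rTensor (C ⊗[K] C) (Coalgebra.comul.lTensor C s)) := by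
    intro s
    induction s using TensorProduct.induction_on with
    | zero => simp
    | add x y hx hy => simp only [map_add, hx, hy]
    | tmul x y => simp
  have e : (f * g).ofConv =
      (LinearMap.mul' K K ∘ₗ TensorProduct.map f.ofConv g.ofConv) ∘ₗ Coalgebra.comul := rfl
  have k := key (Coalgebra.comul.rTensor C (Coalgebra.comul c))
  rw [Coalgebra.coassoc_apply, ← comm] at k
  simp only [rightHit, e, LinearMap.rTensor_comp, LinearMap.comp_apply, LinearEquiv.coe_coe]
    at k ⊢
  exact k

variable (K C)

/-- The left `C^*`-module structure `f ⇀ c = ∑ f(c₂) c₁` on `C`. -/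
@[reducible] noncomputable def leftDualModule : Module (DualAlg K C) C where
  smul f c := leftHit f c
  one_smul := leftHit_one
  mul_smul := leftHit_mul
  smul_zero f := map_zero (leftHit f)
  smul_add f := map_add (leftHit f)
  add_smul f g c := by
    change leftHit (f + g) c = leftHit f c + leftHit g c
    simp [leftHit, LinearMap.lTensor_add]
  zero_smul c := by
    change leftHit 0 c = 0
    simp [leftHit]

/-- The right `C^*`-module structure `c ↼ f = ∑ f(c₁) c₂` on `C`, as usual written as a left
module structure over the opposite ring. -/
@[reducible] noncomputable def rightDualModule : Module (DualAlg K C)ᵐᵒᵖ C where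
  smul f c := rightHit f.unop c
  one_smul := rightHit_one
  mul_smul f g c := rightHit_mul g.unop f.unop c
  smul_zero f := map_zero (rightHit f.unop)
  smul_add f := map_add (rightHit f.unop)
  add_smul f g c := by
    change rightHit (f.unop + g.unop) c = rightHit f.unop c + rightHit g.unop c
    simp [rightHit, LinearMap.rTensor_add]
  zero_smul c := by
    change rightHit 0 c = 0
    simp [rightHit]

attribute [local instance] leftDualModule rightDualModule

/-- `C` embeds in `C^*` as a left `C^*`-module. -/
def IsLeftCoFrobenius : Prop :=
  ∃ φ : C →ₗ[DualAlg K C] DualAlg K C, Function.Injective φ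

/-- `C` embeds in `C^*` as a right `C^*`-module. -/
def IsRightCoFrobenius : Prop :=
  ∃ φ : C →ₗ[(DualAlg K C)ᵐᵒᵖ] DualAlg K C, Function.Injective φ

/-- `C` embeds in a free left `C^*`-module. (An embedding into a free module of any size uses at
most as many coordinates as the universe of `C` provides, so taking `I : Type v` is no
restriction.) -/
def IsLeftQcF : Prop :=
  ∃ (I : Type v) (φ : C →ₗ[DualAlg K C] (I →₀ DualAlg K C)), Function.Injective φ

/-- `C` embeds in a free right `C^*`-module. -/
def IsRightQcF : Prop :=
  ∃ (I : Type v) (φ : C →ₗ[(DualAlg K C)ᵐᵒᵖ] (I →₀ DualAlg K C)), Function.Injective φ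

variable {C}

/-- `D` is a subcoalgebra of `C`: `Δ(D) ⊆ D ⊗ D`. -/
def IsSubcoalgebra (D : Submodule K C) : Prop :=
  ∀ x ∈ D, (Coalgebra.comul x : C ⊗[K] C) ∈
    LinearMap.range (TensorProduct.map D.subtype D.subtype)

/-- `D` is a simple subcoalgebra of `C`: nonzero, without proper nonzero subcoalgebras. -/
def IsSimpleSubcoalgebra (D : Submodule K C) : Prop :=
  IsSubcoalgebra K D ∧ D ≠ ⊥ ∧ ∀ E : Submodule K C, E ≤ D → IsSubcoalgebra K E → E = ⊥ ∨ E = D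

variable (C)

/-- `C` is cosemisimple: it is the sum of its simple subcoalgebras, that is, it equals its
coradical. -/
def IsCosemisimple : Prop :=
  sSup {D : Submodule K C | IsSimpleSubcoalgebra K D} = ⊤

end Coalg

/-! ## The path coalgebra of a quiver -/

section PathCoalg

/-- All the paths of a quiver, including the paths of length zero (the vertices). -/
abbrev AllPaths (V : Type u) [Quiver.{w} V] : Type (max u w) :=
  Σ a b : V, Quiver.Path a b

namespace Quiver.Path

variable {V : Type u} [Quiver.{w} V]

/-- The list of the pairs of paths `(q, r)` with `q r = p`. -/
def cuts {a : V} : {b : V} → Quiver.Path a b → List (Σ c : V, Quiver.Path a c × Quiver.Path c b)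
  | _, .nil => [⟨a, .nil, .nil⟩]
  | _, .cons p e => ⟨_, p.cons e, .nil⟩ :: p.cuts.map fun x => ⟨x.1, x.2.1, x.2.2.cons e⟩

theorem mem_cuts {a b : V} (p : Quiver.Path a b) (x : Σ c : V, Quiver.Path a c × Quiver.Path c b) :
    x ∈ p.cuts ↔ x.2.1.comp x.2.2 = p := by
  induction p with
  | nil =>
    obtain ⟨c, q, r⟩ := x
    cases r with
    | nil => simp [cuts]
    | cons r e =>
      simp only [cuts, List.mem_singleton, Sigma.mk.injEq, comp_cons, reduceCtorEq, iff_false]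
      rintro ⟨rfl, h⟩
      simp at h
  | cons p e ih =>
    obtain ⟨c, q, r⟩ := x
    cases r with
    | nil =>
      simp only [cuts, List.mem_cons, List.mem_map, comp_nil]
      constructor
      · rintro (h | ⟨⟨d, s, t⟩, -, h⟩)
        · simpa using h
        · simp only [Sigma.mk.injEq] at h
          obtain ⟨rfl, h⟩ := h
          simp at h
      · rintro rfl
        exact Or.inl rfl
    | cons r e' =>
      simp only [cuts, List.mem_cons, List.mem_map, ih, comp_cons]
      constructor
      · rintro (h | ⟨⟨d, s, t⟩, hst, h⟩)
        · simp only [Sigma.mk.injEq] at h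
          obtain ⟨rfl, h⟩ := h
          simp at h
        · simp only [Sigma.mk.injEq] at h
          obtain ⟨rfl, h⟩ := h
          simp only [heq_eq_eq, Prod.mk.injEq, cons.injEq] at h
          obtain ⟨rfl, rfl, h1, h2⟩ := h
          subst hst
          simp_all
      · intro h
        simp only [cons.injEq] at h
        obtain ⟨rfl, h1, h2⟩ := h
        right
        refine ⟨⟨_, q, r⟩, eq_of_heq h1, ?_⟩
        rw [eq_of_heq h2]

theorem nodup_cuts {a b : V} (p : Quiver.Path a b) : p.cuts.Nodup := by
  induction p with
  | nil => simp [cuts]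
  | cons p e ih =>
    simp only [cuts, List.nodup_cons, List.mem_map, not_exists, not_and]
    refine ⟨?_, ih.map ?_⟩
    · rintro ⟨d, s, t⟩ - h
      simp only [Sigma.mk.injEq] at h
      obtain ⟨rfl, h⟩ := h
      simp at h
    · rintro ⟨d, s, t⟩ ⟨d', s', t'⟩ h
      simp only [Sigma.mk.injEq] at h
      obtain ⟨rfl, h⟩ := h
      simp only [heq_eq_eq, Prod.mk.injEq, cons.injEq] at h
      obtain ⟨rfl, -, h, -⟩ := h
      rw [h]

theorem cuts_assoc {M : Type*} [AddCommMonoid M] {a b : V} (p : Quiver.Path a b)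
    (F : ∀ c d : V, Quiver.Path a c → Quiver.Path c d → Quiver.Path d b → M) :
    (p.cuts.map fun x => (x.2.1.cuts.map fun y => F _ _ y.2.1 y.2.2 x.2.2).sum).sum =
      (p.cuts.map fun x => (x.2.2.cuts.map fun y => F _ _ x.2.1 y.2.1 y.2.2).sum).sum := by
  induction p with
  | nil => simp [cuts]
  | cons p e ih =>
    have h := ih fun c d q r s => F c d q r (s.cons e)
    simp only [cuts, List.map_cons, List.sum_cons, List.map_map, Function.comp_def,
      List.sum_map_add, List.map_nil, List.sum_nil, add_zero, h, add_assoc]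

theorem cuts_counit_left {K M : Type*} [Semiring K] [AddCommMonoid M] [Module K M]
    {a b : V} (p : Quiver.Path a b) (F : ∀ c : V, Quiver.Path c b → M) :
    (p.cuts.map fun x => (if x.2.1.length = 0 then (1 : K) else 0) • F _ x.2.2).sum = F _ p := by
  induction p with
  | nil => simp [cuts]
  | cons p e ih =>
    have h := ih fun c r => F c (r.cons e)
    simp only [cuts, List.map_cons, List.sum_cons, List.map_map, Function.comp_def, h]
    simp

theorem cuts_counit_right {K M : Type*} [Semiring K] [AddCommMonoid M] [Module K M]
    {a b : V} (p : Quiver.Path a b) (F : ∀ c : V, Quiver.Path a c → M) :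
    (p.cuts.map fun x => (if x.2.2.length = 0 then (1 : K) else 0) • F _ x.2.1).sum = F _ p := by
  cases p with
  | nil => simp [cuts]
  | cons p e => simp [cuts, Function.comp_def]

end Quiver.Path

variable (K : Type v) [Field K] (V : Type u) [Quiver.{w} V]

/-- The vector space with basis all the paths of the quiver. (A type synonym, because
`Finsupp` itself carries another coalgebra structure.) -/
def PathCoalgebra : Type (max u v w) := AllPaths V →₀ K

namespace PathCoalgebra

noncomputable instance : AddCommGroup (PathCoalgebra K V) :=
  inferInstanceAs (AddCommGroup (AllPaths V →₀ K))

noncomputable instance : Module K (PathCoalgebra K V) :=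
  inferInstanceAs (Module K (AllPaths V →₀ K))

/-- The basis of the path coalgebra consisting of the paths. -/
noncomputable def basis : Module.Basis (AllPaths V) K (PathCoalgebra K V) :=
  Module.Basis.ofRepr (LinearEquiv.refl K (AllPaths V →₀ K))

variable {V}

/-- The basis element of a path. -/
noncomputable def ofPath {a b : V} (p : Quiver.Path a b) : PathCoalgebra K V :=
  basis K V ⟨a, b, p⟩

/-- The counit takes a path of length zero to `1` and any other path to `0`;
`Δ(p) = ∑_{qr = p} q ⊗ r`. -/
noncomputable instance : CoalgebraStruct K (PathCoalgebra K V) where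
  comul := (basis K V).constr K fun p =>
    (p.2.2.cuts.map fun x => ofPath K x.2.1 ⊗ₜ[K] ofPath K x.2.2).sum
  counit := (basis K V).constr K fun p => if p.2.2.length = 0 then 1 else 0

theorem comul_ofPath {a b : V} (p : Quiver.Path a b) :
    (CoalgebraStruct.comul (ofPath K p) : PathCoalgebra K V ⊗[K] PathCoalgebra K V) =
      (p.cuts.map fun x => ofPath K x.2.1 ⊗ₜ[K] ofPath K x.2.2).sum := by
  simp only [CoalgebraStruct.comul]
  unfold ofPath
  rw [Module.Basis.constr_basis]

theorem counit_ofPath {a b : V} (p : Quiver.Path a b) :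
    (CoalgebraStruct.counit (ofPath K p) : K) = if p.length = 0 then 1 else 0 := by
  simp only [CoalgebraStruct.counit]
  unfold ofPath
  rw [Module.Basis.constr_basis]

theorem list_sum_tmul {ι A B : Type*} [AddCommGroup A] [Module K A] [AddCommGroup B] [Module K B]
    (l : List ι) (f : ι → A) (b : B) :
    (l.map f).sum ⊗ₜ[K] b = (l.map fun i => f i ⊗ₜ[K] b).sum := by
  induction l with
  | nil => simp
  | cons i l ih => simp [TensorProduct.add_tmul, ih]

theorem tmul_list_sum {ι A B : Type*} [AddCommGroup A] [Module K A] [AddCommGroup B] [Module K B]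
    (l : List ι) (f : ι → B) (a : A) :
    a ⊗ₜ[K] (l.map f).sum = (l.map fun i => a ⊗ₜ[K] f i).sum := by
  induction l with
  | nil => simp
  | cons i l ih => simp [TensorProduct.tmul_add, ih]

noncomputable instance : Coalgebra K (PathCoalgebra K V) where
  coassoc := by
    refine (basis K V).ext fun ⟨a, b, p⟩ => ?_
    change TensorProduct.assoc K _ _ _ (CoalgebraStruct.comul.rTensor _
      (CoalgebraStruct.comul (ofPath K p))) =
      CoalgebraStruct.comul.lTensor _ (CoalgebraStruct.comul (ofPath K p))
    have h := p.cuts_assoc fun c d q r s => ofPath K q ⊗ₜ[K] (ofPath K r ⊗ₜ[K] ofPath K s)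
    simpa only [comul_ofPath, map_list_sum, List.map_map, Function.comp_def,
      LinearMap.rTensor_tmul, LinearMap.lTensor_tmul, list_sum_tmul, tmul_list_sum,
      TensorProduct.assoc_tmul] using h
  rTensor_counit_comp_comul := by
    refine (basis K V).ext fun ⟨a, b, p⟩ => ?_
    change CoalgebraStruct.counit.rTensor _ (CoalgebraStruct.comul (ofPath K p)) =
      (1 : K) ⊗ₜ[K] ofPath K p
    have h := p.cuts_counit_left (K := K) fun c r => (1 : K) ⊗ₜ[K] ofPath K r
    simpa only [comul_ofPath, map_list_sum, List.map_map, Function.comp_def,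
      LinearMap.rTensor_tmul, counit_ofPath, TensorProduct.smul_tmul', smul_eq_mul, mul_one]
      using h
  lTensor_counit_comp_comul := by
    refine (basis K V).ext fun ⟨a, b, p⟩ => ?_
    change CoalgebraStruct.counit.lTensor _ (CoalgebraStruct.comul (ofPath K p)) =
      ofPath K p ⊗ₜ[K] (1 : K)
    have h := p.cuts_counit_right (K := K) fun c r => ofPath K r ⊗ₜ[K] (1 : K)
    simpa only [comul_ofPath, map_list_sum, List.map_map, Function.comp_def,
      LinearMap.lTensor_tmul, counit_ofPath, ← TensorProduct.tmul_smul, smul_eq_mul, mul_one]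
      using h

end PathCoalgebra

end PathCoalg

/-! ## The incidence coalgebra of a locally finite partially ordered set -/

section IncidenceCoalg

variable (K : Type v) [Field K] (X : Type u) [PartialOrder X]

/-- The vector space with basis the segments `e_{x,y}`, `x ≤ y`, of the poset. -/
def IncidenceCoalgebra : Type (max u v) := {p : X × X // p.1 ≤ p.2} →₀ K

namespace IncidenceCoalgebra

noncomputable instance : AddCommGroup (IncidenceCoalgebra K X) :=
  inferInstanceAs (AddCommGroup ({p : X × X // p.1 ≤ p.2} →₀ K))

noncomputable instance : Module K (IncidenceCoalgebra K X) :=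
  inferInstanceAs (Module K ({p : X × X // p.1 ≤ p.2} →₀ K))

/-- The basis of the incidence coalgebra consisting of the segments. -/
noncomputable def basis :
    Module.Basis {p : X × X // p.1 ≤ p.2} K (IncidenceCoalgebra K X) :=
  Module.Basis.ofRepr (LinearEquiv.refl K ({p : X × X // p.1 ≤ p.2} →₀ K))

variable {X}

/-- The segment `e_{x,y}`. -/
noncomputable def seg (x y : X) (h : x ≤ y) : IncidenceCoalgebra K X :=
  basis K X ⟨(x, y), h⟩

variable [LocallyFiniteOrder X]

open Classical in
/-- `Δ(e_{x,y}) = ∑_{x ≤ z ≤ y} e_{x,z} ⊗ e_{z,y}` and `ε(e_{x,y}) = δ_{x,y}`. -/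
noncomputable instance : CoalgebraStruct K (IncidenceCoalgebra K X) where
  comul := (basis K X).constr K fun p =>
    ∑ z ∈ (Finset.Icc p.1.1 p.1.2).attach,
      seg K p.1.1 z.1 (Finset.mem_Icc.1 z.2).1 ⊗ₜ[K] seg K z.1 p.1.2 (Finset.mem_Icc.1 z.2).2
  counit := (basis K X).constr K fun p => if p.1.1 = p.1.2 then 1 else 0

theorem comul_seg (x y : X) (h : x ≤ y) :
    (CoalgebraStruct.comul (seg K x y h) : IncidenceCoalgebra K X ⊗[K] IncidenceCoalgebra K X) =
      ∑ z ∈ (Finset.Icc x y).attach,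
        seg K x z.1 (Finset.mem_Icc.1 z.2).1 ⊗ₜ[K] seg K z.1 y (Finset.mem_Icc.1 z.2).2 := by
  simp only [CoalgebraStruct.comul]
  unfold seg
  rw [Module.Basis.constr_basis]

open Classical in
theorem counit_seg (x y : X) (h : x ≤ y) :
    (CoalgebraStruct.counit (seg K x y h) : K) = if x = y then 1 else 0 := by
  simp only [CoalgebraStruct.counit]
  unfold seg
  rw [Module.Basis.constr_basis]

noncomputable instance : Coalgebra K (IncidenceCoalgebra K X) where
  coassoc := by
    refine (basis K X).ext fun ⟨⟨x, y⟩, hxy⟩ => ?_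
    change TensorProduct.assoc K _ _ _ (CoalgebraStruct.comul.rTensor _
      (CoalgebraStruct.comul (seg K x y hxy))) =
      CoalgebraStruct.comul.lTensor _ (CoalgebraStruct.comul (seg K x y hxy))
    simp only [comul_seg, map_sum, LinearMap.rTensor_tmul, LinearMap.lTensor_tmul,
      TensorProduct.sum_tmul, TensorProduct.tmul_sum, TensorProduct.assoc_tmul]
    rw [Finset.sum_sigma', Finset.sum_sigma']
    refine Finset.sum_bij'
      (fun p _ => ⟨⟨p.2.1, ?_⟩, ⟨p.1.1, ?_⟩⟩) (fun p _ => ⟨⟨p.2.1, ?_⟩, ⟨p.1.1, ?_⟩⟩)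
      ?_ ?_ ?_ ?_ ?_
    · have h1 := Finset.mem_Icc.1 p.1.2
      have h2 := Finset.mem_Icc.1 p.2.2
      exact Finset.mem_Icc.2 ⟨h2.1, h2.2.trans h1.2⟩
    · have h1 := Finset.mem_Icc.1 p.1.2
      have h2 := Finset.mem_Icc.1 p.2.2
      exact Finset.mem_Icc.2 ⟨h2.2, h1.2⟩
    · have h1 := Finset.mem_Icc.1 p.1.2
      have h2 := Finset.mem_Icc.1 p.2.2
      exact Finset.mem_Icc.2 ⟨h1.1.trans h2.1, h2.2⟩
    · have h1 := Finset.mem_Icc.1 p.1.2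
      have h2 := Finset.mem_Icc.1 p.2.2
      exact Finset.mem_Icc.2 ⟨h1.1, h2.1⟩
    · intros; simp
    · intros; simp
    · intros; rfl
    · intros; rfl
    · intros; rfl
  rTensor_counit_comp_comul := by
    refine (basis K X).ext fun ⟨⟨x, y⟩, hxy⟩ => ?_
    change CoalgebraStruct.counit.rTensor _ (CoalgebraStruct.comul (seg K x y hxy)) =
      (1 : K) ⊗ₜ[K] seg K x y hxy
    simp only [comul_seg, map_sum, LinearMap.rTensor_tmul, counit_seg]
    rw [Finset.sum_eq_single ⟨x, Finset.mem_Icc.2 ⟨le_rfl, hxy⟩⟩]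
    · simp
    · intro z _ hz
      rw [if_neg (fun h => hz (Subtype.ext h.symm)), TensorProduct.zero_tmul]
    · intro h
      exact absurd (Finset.mem_attach _ _) h
  lTensor_counit_comp_comul := by
    refine (basis K X).ext fun ⟨⟨x, y⟩, hxy⟩ => ?_
    change CoalgebraStruct.counit.lTensor _ (CoalgebraStruct.comul (seg K x y hxy)) =
      seg K x y hxy ⊗ₜ[K] (1 : K)
    simp only [comul_seg, map_sum, LinearMap.lTensor_tmul, counit_seg]
    rw [Finset.sum_eq_single ⟨y, Finset.mem_Icc.2 ⟨hxy, le_rfl⟩⟩]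
    · simp
    · intro z _ hz
      rw [if_neg (fun h => hz (Subtype.ext h)), TensorProduct.tmul_zero]
    · intro h
      exact absurd (Finset.mem_attach _ _) h

end IncidenceCoalgebra

end IncidenceCoalg

/-! Everything rests on grouplike elements, here the vertices `v` of the quiver and the segments
`e_{x,x}` of the poset.

Both QcF conditions fail as soon as there is an arrow. A grouplike `g` satisfies `f ⇀ g = f(g) g`,
so if `f(g) = 0`, a left module map `φ` to a free module gives `f * φ(g) = 0` in each coordinate.
This says that each coordinate of `φ(g)` vanishes on every `d ↼ f`. If such elements exhaust a
basis, then `φ(g) = 0` and `φ` is not injective (`not_isLeftQcF_of_rightHit`). For an arrow `e : a ⟶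
b` take `g = b`: a path `q` starting at `b` is `(e q) ↼ e^*`, a path `q` starting at `c ≠ b` is `q ↼
c^*`, and both functionals kill `b`. For a pair `x < y` in a poset, `g = e_{y,y}` plays the same
role. The right-hand version uses the source `a`, or `e_{x,x}`.

For cosemisimplicity, hitting a nonzero element with the functional dual to a maximal member of its
support leaves a scalar multiple of a grouplike basis vector. Hence every simple subcoalgebra is the
line through one of these, and their sum is the whole coalgebra only if no other basis vectors exist
(`IsCosemisimple.mem_of_basis`).

Conversely, without arrows or strict inequalities the whole basis is grouplike. The lines through
the basis vectors are then simple subcoalgebras with sum `C`, and sending each basis vector to its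
coordinate functional embeds `C` in `C^*` on both sides. -/

/-! ### Grouplike elements as an obstruction to embedding in a free module -/

section Grouplike

variable {K : Type u} {C : Type v} [Field K] [AddCommGroup C] [Module K C] [Coalgebra K C]

attribute [local instance] leftDualModule rightDualModule

/-- The scalar `f(d₁)` in `∑ f(d₁) h(d₂)` can be moved inside `h`. Thus `f * h = 0` means that `h`
vanishes on the image of `rightHit f`. -/
theorem mul_ofConv_apply_rightHit (f h : DualAlg K C) (d : C) :
    (f * h).ofConv d = h.ofConv (rightHit f d) := by
  have key : ∀ t : C ⊗[K] C, LinearMap.mul' K K (TensorProduct.map f.ofConv h.ofConv t) =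
      h.ofConv (TensorProduct.lid K C (f.ofConv.rTensor C t)) := by
    intro t
    induction t using TensorProduct.induction_on with
    | zero => simp
    | add x y hx hy => simp only [map_add, hx, hy]
    | tmul x y => simp
  exact key (Coalgebra.comul d)

theorem mul_ofConv_apply_leftHit (h f : DualAlg K C) (d : C) :
    (h * f).ofConv d = h.ofConv (leftHit f d) := by
  have key : ∀ t : C ⊗[K] C, LinearMap.mul' K K (TensorProduct.map h.ofConv f.ofConv t) =
      h.ofConv (TensorProduct.rid K C (f.ofConv.lTensor C t)) := by
    intro t
    induction t using TensorProduct.induction_on with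
    | zero => simp
    | add x y hx hy => simp only [map_add, hx, hy]
    | tmul x y => simp [mul_comm]
  exact key (Coalgebra.comul d)

theorem leftHit_of_comul_eq {g : C} (hg : Coalgebra.comul (R := K) g = g ⊗ₜ[K] g)
    (f : DualAlg K C) : leftHit f g = f.ofConv g • g := by
  simp [leftHit, hg]

theorem rightHit_of_comul_eq {g : C} (hg : Coalgebra.comul (R := K) g = g ⊗ₜ[K] g)
    (f : DualAlg K C) : rightHit f g = f.ofConv g • g := by
  simp [rightHit, hg]

/-- If every basis vector is of the form `d ↼ f` with `f` vanishing at the grouplike element `g`,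
then every left module map from `C` to a free module kills `g`. -/
theorem not_isLeftQcF_of_rightHit {ι : Type*} (b : Module.Basis ι K C) {g : C} (hg0 : g ≠ 0)
    (hg : Coalgebra.comul (R := K) g = g ⊗ₜ[K] g)
    (H : ∀ i, ∃ (f : DualAlg K C) (d : C), f.ofConv g = 0 ∧ rightHit f d = b i) :
    ¬ IsLeftQcF K C := by
  rintro ⟨I, φ, hφ⟩
  refine hg0 (hφ ?_)
  rw [map_zero]
  refine Finsupp.ext fun j => WithConv.ofConv_injective (b.ext fun i => ?_)
  obtain ⟨f, d, hf, hd⟩ := H i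
  -- The line through `g` is a submodule on which `f` acts as the scalar `f(g)`.
  have h0 : f • g = 0 := by
    change leftHit f g = 0
    rw [leftHit_of_comul_eq hg, hf, zero_smul]
  have h1 : f * φ g j = 0 := by
    rw [← smul_eq_mul, ← Finsupp.smul_apply, ← map_smul, h0, map_zero, Finsupp.zero_apply]
  rw [← hd, ← mul_ofConv_apply_rightHit, h1]
  rfl

/-- If every basis vector is of the form `f ⇀ d` with `f` vanishing at the grouplike element `g`,
then every right module map from `C` to a free module kills `g`. -/
theorem not_isRightQcF_of_leftHit {ι : Type*} (b : Module.Basis ι K C) {g : C} (hg0 : g ≠ 0)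
    (hg : Coalgebra.comul (R := K) g = g ⊗ₜ[K] g)
    (H : ∀ i, ∃ (f : DualAlg K C) (d : C), f.ofConv g = 0 ∧ leftHit f d = b i) :
    ¬ IsRightQcF K C := by
  rintro ⟨I, φ, hφ⟩
  refine hg0 (hφ ?_)
  rw [map_zero]
  refine Finsupp.ext fun j => WithConv.ofConv_injective (b.ext fun i => ?_)
  obtain ⟨f, d, hf, hd⟩ := H i
  have h0 : MulOpposite.op f • g = 0 := by
    change rightHit f g = 0
    rw [rightHit_of_comul_eq hg, hf, zero_smul]
  have h1 : φ g j * f = 0 := by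
    rw [← op_smul_eq_mul, ← Finsupp.smul_apply, ← map_smul, h0, map_zero, Finsupp.zero_apply]
  rw [← hd, ← mul_ofConv_apply_leftHit, h1]
  rfl

/-! ### Coalgebras with a grouplike basis are co-Frobenius -/

theorem IsLeftCoFrobenius.isLeftQcF (h : IsLeftCoFrobenius K C) : IsLeftQcF K C := by
  obtain ⟨φ, hφ⟩ := h
  exact ⟨PUnit, Finsupp.lsingle PUnit.unit ∘ₗ φ, (Finsupp.single_injective _).comp hφ⟩

theorem IsRightCoFrobenius.isRightQcF (h : IsRightCoFrobenius K C) : IsRightQcF K C := by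
  obtain ⟨φ, hφ⟩ := h
  exact ⟨PUnit, Finsupp.lsingle PUnit.unit ∘ₗ φ, (Finsupp.single_injective _).comp hφ⟩

/-- The linear map `C → C^*` taking each basis vector to the corresponding coordinate. -/
noncomputable def coordMap {ι : Type*} (b : Module.Basis ι K C) : C →ₗ[K] DualAlg K C :=
  b.constr K fun i => WithConv.toConv (b.coord i)

omit [Coalgebra K C] in
theorem coordMap_basis {ι : Type*} (b : Module.Basis ι K C) (i : ι) :
    coordMap b (b i) = WithConv.toConv (b.coord i) :=
  b.constr_basis K _ i

theorem coordMap_apply_basis {ι : Type*} (b : Module.Basis ι K C) (c : C) (i : ι) :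
    (coordMap b c).ofConv (b i) = b.repr c i := by
  classical
  induction b.mem_span c using Submodule.span_induction with
  | zero => simp
  | add x y _ _ hx hy => simp [hx, hy]
  | smul r x _ hx => simp [hx]
  | mem x hx =>
    obtain ⟨j, rfl⟩ := hx
    simp [coordMap_basis, Finsupp.single_apply, eq_comm]

theorem coordMap_injective {ι : Type*} (b : Module.Basis ι K C) :
    Function.Injective (coordMap b) := by
  intro c d h
  refine b.repr.injective (Finsupp.ext fun i => ?_)
  rw [← coordMap_apply_basis, h, coordMap_apply_basis]

variable {ι : Type*} (b : Module.Basis ι K C)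

/-- Both actions are diagonal in a grouplike basis: evaluated at `b i`, the images of `f ⇀ c` and `f
* coordMap b c` are both `f(b i)` times the `i`-th coordinate of `c`. -/
theorem isLeftCoFrobenius_of_grouplike_basis
    (hb : ∀ i, Coalgebra.comul (R := K) (b i) = b i ⊗ₜ[K] b i) : IsLeftCoFrobenius K C := by
  refine ⟨{ coordMap b with map_smul' := fun f c => ?_ }, coordMap_injective b⟩
  change coordMap b (leftHit f c) = f * coordMap b c
  refine WithConv.ofConv_injective (b.ext fun i => ?_)
  rw [mul_ofConv_apply_rightHit, rightHit_of_comul_eq (hb i), map_smul, coordMap_apply_basis,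
    coordMap_apply_basis]
  induction b.mem_span c using Submodule.span_induction with
  | zero => simp
  | add x y _ _ hx hy =>
    simp only [map_add, Finsupp.add_apply, smul_eq_mul, mul_add] at *
    rw [hx, hy]
  | smul r x _ hx =>
    simp only [map_smul, Finsupp.smul_apply, smul_eq_mul] at *
    rw [hx]
    ring
  | mem x hx =>
    obtain ⟨j, rfl⟩ := hx
    rw [leftHit_of_comul_eq (hb j)]
    rcases eq_or_ne j i with rfl | h <;> simp_all

theorem isRightCoFrobenius_of_grouplike_basis
    (hb : ∀ i, Coalgebra.comul (R := K) (b i) = b i ⊗ₜ[K] b i) : IsRightCoFrobenius K C := by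
  refine ⟨{ coordMap b with map_smul' := fun f c => ?_ }, coordMap_injective b⟩
  change coordMap b (rightHit f.unop c) = coordMap b c * f.unop
  refine WithConv.ofConv_injective (b.ext fun i => ?_)
  rw [mul_ofConv_apply_leftHit, leftHit_of_comul_eq (hb i), map_smul, coordMap_apply_basis,
    coordMap_apply_basis]
  induction b.mem_span c using Submodule.span_induction with
  | zero => simp
  | add x y _ _ hx hy =>
    simp only [map_add, Finsupp.add_apply, smul_eq_mul, mul_add] at *
    rw [hx, hy]
  | smul r x _ hx =>
    simp only [map_smul, Finsupp.smul_apply, smul_eq_mul] at *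
    rw [hx]
    ring
  | mem x hx =>
    obtain ⟨j, rfl⟩ := hx
    rw [rightHit_of_comul_eq (hb j)]
    rcases eq_or_ne j i with rfl | h <;> simp_all

/-! ### Simple subcoalgebras and grouplike elements -/

theorem isSubcoalgebra_span_singleton {g : C} (hg : Coalgebra.comul (R := K) g = g ⊗ₜ[K] g) :
    IsSubcoalgebra K (K ∙ g) := by
  intro x hx
  obtain ⟨r, rfl⟩ := Submodule.mem_span_singleton.1 hx
  rw [map_smul, hg]
  exact Submodule.smul_mem _ _
    ⟨⟨g, Submodule.mem_span_singleton_self g⟩ ⊗ₜ ⟨g, Submodule.mem_span_singleton_self g⟩, rfl⟩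

theorem isSimpleSubcoalgebra_span_singleton {g : C} (hg0 : g ≠ 0)
    (hg : Coalgebra.comul (R := K) g = g ⊗ₜ[K] g) : IsSimpleSubcoalgebra K (K ∙ g) :=
  ⟨isSubcoalgebra_span_singleton hg, by simpa using hg0, fun _ hE _ =>
    (nonzero_span_atom g hg0).le_iff.1 hE⟩

theorem isCosemisimple_of_grouplike_basis
    (hb : ∀ i, Coalgebra.comul (R := K) (b i) = b i ⊗ₜ[K] b i) : IsCosemisimple K C := by
  rw [IsCosemisimple, eq_top_iff, ← b.span_eq, Submodule.span_le]
  rintro _ ⟨i, rfl⟩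
  exact le_sSup (a := K ∙ b i) (isSimpleSubcoalgebra_span_singleton (b.ne_zero i) (hb i))
    (Submodule.mem_span_singleton_self _)

/-- Applying `f` to the first factor of an element of `D ⊗ D` leaves an element of `D`. -/
theorem IsSubcoalgebra.rightHit_mem {D : Submodule K C} (hD : IsSubcoalgebra K D)
    (f : DualAlg K C) {x : C} (hx : x ∈ D) : rightHit f x ∈ D := by
  obtain ⟨t, ht⟩ := hD x hx
  simp only [rightHit, LinearMap.comp_apply, ← ht]
  clear ht
  induction t using TensorProduct.induction_on with
  | zero => simp
  | add x y hx hy => simpa only [map_add] using add_mem hx hy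
  | tmul x y => simpa using D.smul_mem _ y.2

/-- If every nonzero element can be moved to an element of a set `G` of grouplike elements, then
`G` spans the coradical. -/
theorem IsCosemisimple.span_eq_top (h : IsCosemisimple K C) (G : Set C)
    (hG0 : (0 : C) ∉ G) (hG : ∀ g ∈ G, Coalgebra.comul (R := K) g = g ⊗ₜ[K] g)
    (H : ∀ c : C, c ≠ 0 → ∃ (f : DualAlg K C), rightHit f c ∈ G) :
    Submodule.span K G = ⊤ := by
  rw [eq_top_iff, ← h, sSup_le_iff]
  rintro D ⟨hD, hD0, hDs⟩
  obtain ⟨c, hc, hc0⟩ := D.ne_bot_iff.1 hD0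
  obtain ⟨f, hf⟩ := H c hc0
  have hfD := hD.rightHit_mem f hc
  have hne : rightHit f c ≠ 0 := fun h => hG0 (h ▸ hf)
  -- The line through the grouplike element is a nonzero subcoalgebra of the simple `D`, so it is
  -- all of `D`.
  rcases hDs (K ∙ rightHit f c) (by simpa using hfD)
    (isSubcoalgebra_span_singleton (hG _ hf)) with h | h
  · exact absurd h (by simpa using hne)
  · rw [← h]
    exact Submodule.span_mono (by simpa using hf)

/-- A coalgebra with a basis `b` such that every nonzero element can be moved to a grouplike basis
element is cosemisimple only if all the basis vectors are grouplike. -/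
theorem IsCosemisimple.mem_of_basis (h : IsCosemisimple K C) (s : Set ι)
    (hs : ∀ i ∈ s, Coalgebra.comul (R := K) (b i) = b i ⊗ₜ[K] b i)
    (H : ∀ c : C, c ≠ 0 → ∃ (f : DualAlg K C) (i : ι), i ∈ s ∧ rightHit f c = b i) (i : ι) :
    i ∈ s := by
  have h1 := h.span_eq_top (b '' s) (by rintro ⟨i, -, hi⟩; exact b.ne_zero i hi)
    (by rintro _ ⟨i, hi, rfl⟩; exact hs i hi)
    (fun c hc => let ⟨f, i, hi, hf⟩ := H c hc; ⟨f, i, hi, hf.symm⟩)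
  have h2 := b.mem_span_image.1 (h1 ▸ Submodule.mem_top : b i ∈ Submodule.span K (b '' s))
  exact h2 (by simp)

end Grouplike

/-! ### Path coalgebras -/

section PathCoalg

variable (K : Type v) [Field K] {V : Type u} [Quiver.{w} V]

namespace PathCoalgebra

theorem basis_apply {a b : V} (p : Quiver.Path a b) : basis K V ⟨a, b, p⟩ = ofPath K p := rfl

theorem comul_nil (a : V) :
    Coalgebra.comul (R := K) (ofPath K (Quiver.Path.nil : Quiver.Path a a)) =
    ofPath K (Quiver.Path.nil : Quiver.Path a a) ⊗ₜ[K]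
      ofPath K (Quiver.Path.nil : Quiver.Path a a) := by
  rw [comul_ofPath]
  simp [Quiver.Path.cuts]

/-- The element of the dual algebra reading off the coefficient of a path. -/
noncomputable def dualPath {a b : V} (p : Quiver.Path a b) : DualAlg K (PathCoalgebra K V) :=
  WithConv.toConv ((basis K V).coord ⟨a, b, p⟩)

theorem dualPath_self {a b : V} (p : Quiver.Path a b) :
    (dualPath K p).ofConv (ofPath K p) = 1 := by
  simp [dualPath, ← basis_apply]

theorem dualPath_of_ne {a b c d : V} {p : Quiver.Path a b} {q : Quiver.Path c d}
    (h : (⟨c, d, q⟩ : AllPaths V) ≠ ⟨a, b, p⟩) : (dualPath K p).ofConv (ofPath K q) = 0 := by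
  simp only [dualPath, ← basis_apply, WithConv.ofConv_toConv, Module.Basis.coord_apply,
    Module.Basis.repr_self]
  exact Finsupp.single_eq_of_ne h.symm

theorem rightHit_ofPath (f : DualAlg K (PathCoalgebra K V)) {a b : V} (p : Quiver.Path a b) :
    rightHit f (ofPath K p) =
      (p.cuts.map fun x => f.ofConv (ofPath K x.2.1) • ofPath K x.2.2).sum := by
  simp only [rightHit, LinearMap.comp_apply, comul_ofPath, map_list_sum, List.map_map,
    Function.comp_def]
  simp

theorem leftHit_ofPath (f : DualAlg K (PathCoalgebra K V)) {a b : V} (p : Quiver.Path a b) :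
    leftHit f (ofPath K p) =
      (p.cuts.map fun x => f.ofConv (ofPath K x.2.2) • ofPath K x.2.1).sum := by
  simp only [leftHit, LinearMap.comp_apply, comul_ofPath, map_list_sum, List.map_map,
    Function.comp_def]
  simp

theorem _root_.List.Nodup.sum_map_eq_single {α M : Type*} [AddCommMonoid M] {l : List α}
    (hl : l.Nodup) {x : α} (hx : x ∈ l) (f : α → M) (h : ∀ y ∈ l, y ≠ x → f y = 0) :
    (l.map f).sum = f x := by
  classical
  rw [← List.sum_toFinset f hl]
  exact Finset.sum_eq_single x (fun y hy => h y (List.mem_toFinset.1 hy))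
    fun h => absurd (List.mem_toFinset.2 hx) h

/-- Paths cancel on the left, so exactly one factorization of `p.comp q` has `p` as its first
factor, and it occurs once among the cuts. -/
theorem rightHit_dualPath_comp {a b c : V} (p : Quiver.Path a b) (q : Quiver.Path b c) :
    rightHit (dualPath K p) (ofPath K (p.comp q)) = ofPath K q := by
  rw [rightHit_ofPath, (p.comp q).nodup_cuts.sum_map_eq_single (x := ⟨b, p, q⟩)
    ((Quiver.Path.mem_cuts _ _).2 rfl), dualPath_self, one_smul]
  rintro ⟨d, r, s⟩ hy hne
  rw [dualPath_of_ne, zero_smul]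
  intro h
  obtain ⟨rfl, h⟩ : d = b ∧ HEq r p := by simpa using h
  obtain rfl := eq_of_heq h
  rw [Quiver.Path.mem_cuts] at hy
  obtain rfl := Quiver.Path.comp_inj_right.1 hy
  exact hne rfl

theorem leftHit_dualPath_comp {a b c : V} (p : Quiver.Path a b) (q : Quiver.Path b c) :
    leftHit (dualPath K q) (ofPath K (p.comp q)) = ofPath K p := by
  rw [leftHit_ofPath, (p.comp q).nodup_cuts.sum_map_eq_single (x := ⟨b, p, q⟩)
    ((Quiver.Path.mem_cuts _ _).2 rfl), dualPath_self, one_smul]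
  rintro ⟨d, r, s⟩ hy hne
  rw [dualPath_of_ne, zero_smul]
  intro h
  obtain ⟨rfl, h⟩ := Sigma.mk.inj_iff.1 h
  obtain ⟨-, h⟩ := Sigma.mk.inj_iff.1 (eq_of_heq h)
  obtain rfl := eq_of_heq h
  rw [Quiver.Path.mem_cuts] at hy
  obtain rfl := Quiver.Path.comp_inj_left.1 hy
  exact hne rfl

/-- A nonzero term requires `p` to be an initial segment of `q`; as `q` is no longer than `p`, the
remaining factor is trivial and `q = p`. -/
theorem rightHit_dualPath_of_length_le {a b c d : V} (p : Quiver.Path a b) (q : Quiver.Path c d)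
    (hle : q.length ≤ p.length) (hne : (⟨c, d, q⟩ : AllPaths V) ≠ ⟨a, b, p⟩) :
    rightHit (dualPath K p) (ofPath K q) = 0 := by
  rw [rightHit_ofPath]
  refine List.sum_eq_zero fun y hy => ?_
  obtain ⟨⟨e, r, s⟩, hx, rfl⟩ := List.mem_map.1 hy
  rw [Quiver.Path.mem_cuts] at hx
  rw [dualPath_of_ne, zero_smul]
  intro h
  obtain ⟨rfl, h⟩ := Sigma.mk.inj_iff.1 h
  obtain ⟨rfl, h⟩ := Sigma.mk.inj_iff.1 (eq_of_heq h)
  obtain rfl := eq_of_heq h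
  subst hx
  obtain rfl : _ = _ := Quiver.Path.eq_of_length_zero s (by simpa using hle)
  obtain rfl := Quiver.Path.eq_nil_of_length_zero s (by simpa using hle)
  exact hne rfl

/-- The functional dual to a longest path `p` in the support kills all the other paths of the
support and turns `p` into its end vertex. -/
theorem exists_rightHit_eq_nil (c : PathCoalgebra K V) (hc : c ≠ 0) :
    ∃ (f : DualAlg K (PathCoalgebra K V)) (a : V),
      rightHit f c = ofPath K (Quiver.Path.nil : Quiver.Path a a) := by
  have hsupp : ((basis K V).repr c).support.Nonempty := by simpa using hc
  obtain ⟨⟨a, b, p⟩, hp, hmax⟩ :=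
    ((basis K V).repr c).support.exists_max_image (fun p => p.2.2.length) hsupp
  have h : rightHit (dualPath K p) c =
      (basis K V).repr c ⟨a, b, p⟩ • ofPath K (Quiver.Path.nil : Quiver.Path b b) := by
    conv_lhs => rw [← (basis K V).linearCombination_repr c, Finsupp.linearCombination_apply,
      Finsupp.sum, map_sum]
    rw [Finset.sum_eq_single_of_mem _ hp]
    · rw [map_smul, basis_apply]
      exact congrArg _ (rightHit_dualPath_comp K p .nil)
    · rintro ⟨d, e, q⟩ hq hne
      rw [map_smul, basis_apply, rightHit_dualPath_of_length_le K p q (hmax _ hq) hne, smul_zero]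
  -- Dividing by the coefficient of `p` makes the result the vertex itself.
  refine ⟨((basis K V).repr c ⟨a, b, p⟩)⁻¹ • dualPath K p, b, ?_⟩
  have h2 : rightHit (((basis K V).repr c ⟨a, b, p⟩)⁻¹ • dualPath K p) c =
      ((basis K V).repr c ⟨a, b, p⟩)⁻¹ • rightHit (dualPath K p) c := by
    simp [rightHit, LinearMap.rTensor_smul]
  rw [h2, h, smul_smul, inv_mul_cancel₀ (Finsupp.mem_support_iff.1 hp), one_smul]

theorem isEmpty_hom_of_isCosemisimple (h : IsCosemisimple K (PathCoalgebra K V)) (a b : V) :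
    IsEmpty (a ⟶ b) := by
  refine ⟨fun e => ?_⟩
  have := h.mem_of_basis (basis K V) (Set.range fun a : V => ⟨a, a, .nil⟩)
    (by rintro _ ⟨a, rfl⟩; exact comul_nil K a)
    (fun c hc => let ⟨f, a, hf⟩ := exists_rightHit_eq_nil K c hc; ⟨f, _, ⟨a, rfl⟩, hf⟩)
    ⟨a, b, e.toPath⟩
  obtain ⟨c, hc⟩ := this
  have := congrArg (fun p : AllPaths V => p.2.2.length) hc
  simp at this

theorem ofPath_ne_zero {a b : V} (p : Quiver.Path a b) : ofPath K p ≠ 0 :=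
  (basis K V).ne_zero _

theorem isEmpty_hom_of_isLeftQcF (h : IsLeftQcF K (PathCoalgebra K V)) (a b : V) :
    IsEmpty (a ⟶ b) := by
  -- The grouplike element is the target of `e`. A loop is allowed: `e^*` kills every vertex,
  -- because `e` has length one.
  refine ⟨fun e => not_isLeftQcF_of_rightHit (basis K V) (ofPath_ne_zero K _) (comul_nil K b)
    ?_ h⟩
  rintro ⟨c, d, q⟩
  by_cases hcb : c = b
  · subst hcb
    refine ⟨dualPath K e.toPath, _, dualPath_of_ne K fun h => ?_,
      rightHit_dualPath_comp K e.toPath q⟩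
    have := congrArg (fun p : AllPaths V => p.2.2.length) h
    simp at this
  -- Here the functional is dual to the starting vertex `c` of `q`, which fixes `q` and kills `b ≠
  -- c`.
  · refine ⟨dualPath K .nil, _, dualPath_of_ne K fun h => ?_,
      rightHit_dualPath_comp K .nil q⟩
    exact hcb (congrArg (fun p : AllPaths V => p.1) h).symm

theorem isEmpty_hom_of_isRightQcF (h : IsRightQcF K (PathCoalgebra K V)) (a b : V) :
    IsEmpty (a ⟶ b) := by
  -- On this side final segments are removed, so the grouplike element is the source of `e`.
  refine ⟨fun e => not_isRightQcF_of_leftHit (basis K V) (ofPath_ne_zero K _) (comul_nil K a)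
    ?_ h⟩
  rintro ⟨c, d, q⟩
  by_cases hda : d = a
  · subst hda
    refine ⟨dualPath K e.toPath, _, dualPath_of_ne K fun h => ?_,
      leftHit_dualPath_comp K q e.toPath⟩
    have := congrArg (fun p : AllPaths V => p.2.2.length) h
    simp at this
  · refine ⟨dualPath K .nil, _, dualPath_of_ne K fun h => ?_,
      leftHit_dualPath_comp K q .nil⟩
    exact hda (congrArg (fun p : AllPaths V => p.1) h).symm

theorem comul_basis_of_isEmpty_hom (h : ∀ a b : V, IsEmpty (a ⟶ b)) (p : AllPaths V) :
    Coalgebra.comul (R := K) (basis K V p) = basis K V p ⊗ₜ[K] basis K V p := by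
  obtain ⟨a, b, p⟩ := p
  cases p with
  | nil => exact comul_nil K a
  | cons p e => exact (h _ _).elim e

end PathCoalgebra

end PathCoalg

/-! ### Incidence coalgebras -/

section IncidenceCoalg

variable (K : Type v) [Field K] {X : Type u} [PartialOrder X]

namespace IncidenceCoalgebra

theorem basis_apply (x y : X) (h : x ≤ y) : basis K X ⟨(x, y), h⟩ = seg K x y h := rfl

theorem seg_ne_zero (x y : X) (h : x ≤ y) : seg K x y h ≠ 0 :=
  (basis K X).ne_zero _

variable [LocallyFiniteOrder X]

/-- The element of the dual algebra reading off the coefficient of a segment. -/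
noncomputable def dualSeg (x y : X) (h : x ≤ y) :
    DualAlg K (IncidenceCoalgebra K X) :=
  WithConv.toConv ((basis K X).coord ⟨(x, y), h⟩)

theorem comul_seg_self (x : X) : Coalgebra.comul (R := K) (seg K x x le_rfl) =
    seg K x x le_rfl ⊗ₜ[K] seg K x x le_rfl := by
  rw [comul_seg, Finset.sum_eq_single_of_mem ⟨x, by simp⟩ (Finset.mem_attach _ _)]
  rintro ⟨z, hz⟩ - hne
  rw [Finset.mem_Icc] at hz
  exact absurd (Subtype.ext (le_antisymm hz.2 hz.1)) hne

omit [LocallyFiniteOrder X] in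
theorem dualSeg_self (x y : X) (h : x ≤ y) : (dualSeg K x y h).ofConv (seg K x y h) = 1 := by
  simp [dualSeg, ← basis_apply]

omit [LocallyFiniteOrder X] in
theorem dualSeg_of_ne {x y z t : X} {h : x ≤ y} {h' : z ≤ t} (hne : (z, t) ≠ (x, y)) :
    (dualSeg K x y h).ofConv (seg K z t h') = 0 := by
  simp only [dualSeg, ← basis_apply, WithConv.ofConv_toConv, Module.Basis.coord_apply,
    Module.Basis.repr_self]
  exact Finsupp.single_eq_of_ne fun h => hne (congrArg Subtype.val h).symm

theorem rightHit_seg (f : DualAlg K (IncidenceCoalgebra K X)) (x y : X) (h : x ≤ y) :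
    rightHit f (seg K x y h) = ∑ z ∈ (Finset.Icc x y).attach,
      f.ofConv (seg K x z.1 (Finset.mem_Icc.1 z.2).1) •
        seg K z.1 y (Finset.mem_Icc.1 z.2).2 := by
  simp only [rightHit, LinearMap.comp_apply, comul_seg, map_sum]
  simp

theorem leftHit_seg (f : DualAlg K (IncidenceCoalgebra K X)) (x y : X) (h : x ≤ y) :
    leftHit f (seg K x y h) = ∑ z ∈ (Finset.Icc x y).attach,
      f.ofConv (seg K z.1 y (Finset.mem_Icc.1 z.2).2) •
        seg K x z.1 (Finset.mem_Icc.1 z.2).1 := by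
  simp only [leftHit, LinearMap.comp_apply, comul_seg, map_sum]
  simp

theorem rightHit_dualSeg {x y z : X} (hxy : x ≤ y) (hyz : y ≤ z) :
    rightHit (dualSeg K x y hxy) (seg K x z (hxy.trans hyz)) = seg K y z hyz := by
  rw [rightHit_seg, Finset.sum_eq_single_of_mem ⟨y, Finset.mem_Icc.2 ⟨hxy, hyz⟩⟩
    (Finset.mem_attach _ _), dualSeg_self, one_smul]
  rintro ⟨t, ht⟩ - hne
  rw [dualSeg_of_ne, zero_smul]
  intro h
  exact hne (Subtype.ext (congrArg Prod.snd h))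

theorem leftHit_dualSeg {x y z : X} (hxy : x ≤ y) (hyz : y ≤ z) :
    leftHit (dualSeg K y z hyz) (seg K x z (hxy.trans hyz)) = seg K x y hxy := by
  rw [leftHit_seg, Finset.sum_eq_single_of_mem ⟨y, Finset.mem_Icc.2 ⟨hxy, hyz⟩⟩
    (Finset.mem_attach _ _), dualSeg_self, one_smul]
  rintro ⟨t, ht⟩ - hne
  rw [dualSeg_of_ne, zero_smul]
  intro h
  exact hne (Subtype.ext (congrArg Prod.fst h))

theorem rightHit_dualSeg_eq_zero {x y z t : X} (hxy : x ≤ y) (hzt : z ≤ t)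
    (h : ¬ (z = x ∧ y ≤ t)) : rightHit (dualSeg K x y hxy) (seg K z t hzt) = 0 := by
  rw [rightHit_seg]
  refine Finset.sum_eq_zero ?_
  rintro ⟨s, hs⟩ -
  rw [dualSeg_of_ne, zero_smul]
  intro h'
  rw [Prod.mk.injEq] at h'
  exact h ⟨h'.1, h'.2 ▸ (Finset.mem_Icc.1 hs).2⟩

/-- The number of elements of `[x, y]`, finite by local finiteness, replaces the length of a path in
the choice of a maximal member of the support. -/
theorem exists_rightHit_eq_seg_self (c : IncidenceCoalgebra K X) (hc : c ≠ 0) :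
    ∃ (f : DualAlg K (IncidenceCoalgebra K X)) (x : X),
      rightHit f c = seg K x x le_rfl := by
  have hsupp : ((basis K X).repr c).support.Nonempty := by simpa using hc
  obtain ⟨⟨⟨x, y⟩, hxy⟩, hp, hmax⟩ :=
    ((basis K X).repr c).support.exists_max_image (fun p => (Finset.Icc p.1.1 p.1.2).card) hsupp
  have h : rightHit (dualSeg K x y hxy) c =
      (basis K X).repr c ⟨(x, y), hxy⟩ • seg K y y le_rfl := by
    conv_lhs => rw [← (basis K X).linearCombination_repr c, Finsupp.linearCombination_apply,
      Finsupp.sum, map_sum]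
    rw [Finset.sum_eq_single_of_mem _ hp]
    · rw [map_smul, basis_apply]
      exact congrArg _ (rightHit_dualSeg K hxy le_rfl)
    · rintro ⟨⟨z, t⟩, hzt⟩ hq hne
      rw [map_smul, basis_apply, rightHit_dualSeg_eq_zero, smul_zero]
      rintro ⟨rfl, hyt⟩
      -- A surviving segment starts at the same point and contains the chosen interval; maximal
      -- cardinality forces the two intervals to agree, hence `t = y`.
      have hsub : Finset.Icc z y ⊆ Finset.Icc z t := Finset.Icc_subset_Icc_right hyt
      have hmem : t ∈ Finset.Icc z y := by
        rw [Finset.eq_of_subset_of_card_le hsub (hmax _ hq)]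
        exact Finset.right_mem_Icc.2 hzt
      obtain rfl := le_antisymm hyt (Finset.mem_Icc.1 hmem).2
      exact hne rfl
  refine ⟨((basis K X).repr c ⟨(x, y), hxy⟩)⁻¹ • dualSeg K x y hxy, y, ?_⟩
  have h2 : rightHit (((basis K X).repr c ⟨(x, y), hxy⟩)⁻¹ • dualSeg K x y hxy) c =
      ((basis K X).repr c ⟨(x, y), hxy⟩)⁻¹ • rightHit (dualSeg K x y hxy) c := by
    simp [rightHit, LinearMap.rTensor_smul]
  rw [h2, h, smul_smul, inv_mul_cancel₀ (Finsupp.mem_support_iff.1 hp), one_smul]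

theorem eq_of_isCosemisimple (h : IsCosemisimple K (IncidenceCoalgebra K X)) (x y : X)
    (hxy : x ≤ y) : x = y := by
  obtain ⟨z, hz⟩ := h.mem_of_basis (basis K X) (Set.range fun x : X => ⟨(x, x), le_rfl⟩)
    (by rintro _ ⟨x, rfl⟩; exact comul_seg_self K x)
    (fun c hc => let ⟨f, x, hf⟩ := exists_rightHit_eq_seg_self K c hc; ⟨f, _, ⟨x, rfl⟩, hf⟩)
    ⟨(x, y), hxy⟩
  obtain ⟨rfl, h⟩ := Prod.mk.inj (congrArg Subtype.val hz)
  exact h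

theorem eq_of_isLeftQcF (h : IsLeftQcF K (IncidenceCoalgebra K X)) (x y : X) (hxy : x ≤ y) :
    x = y := by
  by_contra hne
  -- The upper endpoint of `x < y` acts as the target of an arrow: segments starting at `y` are
  -- extended down to `x`, and all others are fixed by the functional at their lower endpoint.
  refine not_isLeftQcF_of_rightHit (basis K X) (seg_ne_zero K y y le_rfl) (comul_seg_self K y)
    ?_ h
  rintro ⟨⟨z, t⟩, hzt : z ≤ t⟩
  by_cases hzy : z = y
  · subst hzy
    exact ⟨dualSeg K x z hxy, _, dualSeg_of_ne K fun h => hne (congrArg Prod.fst h).symm,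
      rightHit_dualSeg K hxy hzt⟩
  · exact ⟨dualSeg K z z le_rfl, _, dualSeg_of_ne K fun h => hzy (congrArg Prod.fst h).symm,
      rightHit_dualSeg K le_rfl hzt⟩

theorem eq_of_isRightQcF (h : IsRightQcF K (IncidenceCoalgebra K X)) (x y : X) (hxy : x ≤ y) :
    x = y := by
  by_contra hne
  -- Dually, segments ending at `x` are extended up to `y`.
  refine not_isRightQcF_of_leftHit (basis K X) (seg_ne_zero K x x le_rfl) (comul_seg_self K x)
    ?_ h
  rintro ⟨⟨z, t⟩, hzt : z ≤ t⟩
  by_cases htx : t = x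
  · subst htx
    exact ⟨dualSeg K t y hxy, _, dualSeg_of_ne K fun h => hne (congrArg Prod.snd h),
      leftHit_dualSeg K hzt hxy⟩
  · exact ⟨dualSeg K t t le_rfl, _, dualSeg_of_ne K fun h => htx (congrArg Prod.fst h).symm,
      leftHit_dualSeg K hzt le_rfl⟩

theorem comul_basis_of_le_imp_eq (h : ∀ x y : X, x ≤ y → x = y)
    (p : {p : X × X // p.1 ≤ p.2}) :
    Coalgebra.comul (R := K) (basis K X p) = basis K X p ⊗ₜ[K] basis K X p := by
  obtain ⟨⟨x, y⟩, hxy : x ≤ y⟩ := p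
  obtain rfl := h x y hxy
  exact comul_seg_self K x

end IncidenceCoalgebra

end IncidenceCoalg

/-! ### The equivalences, each passing through the combinatorial condition -/

theorem mainTheorem7 (K : Type v) [Field K] :
    (∀ (V : Type u) [Quiver.{w} V],
      List.TFAE [
        IsCosemisimple K (PathCoalgebra K V),
        ∀ a b : V, IsEmpty (a ⟶ b),
        IsLeftQcF K (PathCoalgebra K V),
        IsLeftCoFrobenius K (PathCoalgebra K V),
        IsRightQcF K (PathCoalgebra K V),
        IsRightCoFrobenius K (PathCoalgebra K V)]) ∧
    (∀ (X : Type u) [PartialOrder X] [LocallyFiniteOrder X],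
      List.TFAE [
        IsCosemisimple K (IncidenceCoalgebra K X),
        ∀ x y : X, x ≤ y → x = y,
        IsLeftQcF K (IncidenceCoalgebra K X),
        IsLeftCoFrobenius K (IncidenceCoalgebra K X),
        IsRightQcF K (IncidenceCoalgebra K X),
        IsRightCoFrobenius K (IncidenceCoalgebra K X)]) := by
  refine ⟨fun V _ => ?_, fun X _ _ => ?_⟩
  · tfae_have 1 → 2 := PathCoalgebra.isEmpty_hom_of_isCosemisimple K
    tfae_have 2 → 1 := fun h => isCosemisimple_of_grouplike_basis _
      (PathCoalgebra.comul_basis_of_isEmpty_hom K h)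
    tfae_have 2 → 4 := fun h => isLeftCoFrobenius_of_grouplike_basis _
      (PathCoalgebra.comul_basis_of_isEmpty_hom K h)
    tfae_have 2 → 6 := fun h => isRightCoFrobenius_of_grouplike_basis _
      (PathCoalgebra.comul_basis_of_isEmpty_hom K h)
    tfae_have 4 → 3 := IsLeftCoFrobenius.isLeftQcF
    tfae_have 6 → 5 := IsRightCoFrobenius.isRightQcF
    tfae_have 3 → 2 := PathCoalgebra.isEmpty_hom_of_isLeftQcF K
    tfae_have 5 → 2 := PathCoalgebra.isEmpty_hom_of_isRightQcF K
    tfae_finish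
  · tfae_have 1 → 2 := IncidenceCoalgebra.eq_of_isCosemisimple K
    tfae_have 2 → 1 := fun h => isCosemisimple_of_grouplike_basis _
      (IncidenceCoalgebra.comul_basis_of_le_imp_eq K h)
    tfae_have 2 → 4 := fun h => isLeftCoFrobenius_of_grouplike_basis _
      (IncidenceCoalgebra.comul_basis_of_le_imp_eq K h)
    tfae_have 2 → 6 := fun h => isRightCoFrobenius_of_grouplike_basis _
      (IncidenceCoalgebra.comul_basis_of_le_imp_eq K h)
    tfae_have 4 → 3 := IsLeftCoFrobenius.isLeftQcF
    tfae_have 6 → 5 := IsRightCoFrobenius.isRightQcF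
    tfae_have 3 → 2 := IncidenceCoalgebra.eq_of_isLeftQcF K
    tfae_have 5 → 2 := IncidenceCoalgebra.eq_of_isRightQcF K
    tfae_finish
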